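/- Let $V=\{(x,y)\in\mathbb N^2: 0<x<y\}$ (with the discrete topology) and let $B\subseteq W=\{((x_1,y_1),(x_2,y_2))\in V^2: x_2=y_1\}$. Let $$P=\{(v_n)_{n\ge 1}\in V^{\omega}: (v_n,v_{n+1})\in B\text{ for all }n\ge 1\},$$ a closed subset of the product space $V^\omega$, hence a Polish space. Let $b\in\mathbb R\cup\{-\infty\}$ and let $\ell:V\to[b,\infty)$ be $(B,b)$-target-controlled: for every $\varepsilon\in(0,1)$ there is a positive integer $M$ such that for every $t\in[b,\infty)\cap\mathbb R$ and every $v=(x,y)\in V$ with $y>M$ there is $w\in V$ with $(v,w)\in B$ and $\ell(w)\in[t,t+\varepsilon)$. For a Polish space $X$ and $K\subseteq[-\infty,\infty]$, call a function $f:X\to K$ *upper semi-Baire class $1$* if $\{x\in X: f(x)<r\}$ is a $\boldsymbol\Sigma^0_2$ subset of $X$ for every real $r$, and *$K$-upper semi-Baire class $1$ complete* if it is upper semi-Baire class $1$ and for every upper semi-Baire class $1$ function $g:2^\omega\to K$ there is a continuous $\varphi:2^\omega\to X$ with $g=f\circ\varphi$. **Theorem.** The map $f:P\to[b,\infty]$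 defined by $f\big((v_n)_{n\ge1}\big)=\limsup_{n\to\infty}\ell(v_n)$ is densely onto (that is, $f^{-1}(\{t\})$ is dense in $P$ for every $t\in[b,\infty]$) and $[b,\infty]$-upper semi-Baire class $1$ complete. -/

import Mathlib

open Filter Set

namespace BaireComplete

/-! ### The Borel hierarchy and semi-Baire functions -/

instance polishSpace_pi_of_discrete (A : Type*) [Countable A] [TopologicalSpace A]
    [DiscreteTopology A] : PolishSpace (ℕ → A) := by
  have : SecondCountableTopology A := by
    have : FirstCountableTopology A := inferInstance
    infer_instance
  infer_instance

/-- `IsSigma0 ξ A`: the set `A` belongs to the additive Borel class `Σ⁰_ξ` of the space `X`.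
A set is `Σ⁰_1` iff it is open; for `ξ > 1`, it is `Σ⁰_ξ` iff it is the union of a sequence of
sets `A j`, each of which is `Π⁰_{η j}` (that is, its complement is `Σ⁰_{η j}`) for some `η j < ξ`.
No set is in `Σ⁰_0`, so the indices `η j` are automatically positive. -/
inductive IsSigma0 {X : Type*} [TopologicalSpace X] : Ordinal.{0} → Set X → Prop
  | of_isOpen (A : Set X) (hA : IsOpen A) : IsSigma0 1 A
  | iUnion (ξ : Ordinal.{0}) (hξ : 1 < ξ) (A : ℕ → Set X) (η : ℕ → Ordinal.{0})
      (hη : ∀ j, η j < ξ) (hA : ∀ j, IsSigma0 (η j) (A j)ᶜ) : IsSigma0 ξ (⋃ j, A j)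

/-- A function `f` from a Polish space `X` to a set `K` of extended real numbers is upper
semi-Baire class `ξ` if `f⁻¹([-∞, r))` is `Σ⁰_{ξ+1}` for every real number `r`. -/
def UpperSemiBaire {X : Type*} [TopologicalSpace X] [PolishSpace X] {K : Set EReal}
    (ξ : Ordinal.{0}) (f : X → K) : Prop :=
  ∀ r : ℝ, IsSigma0 (ξ + 1) {x | (f x : EReal) < (r : EReal)}

/-- `f : X → K` is `K`-upper semi-Baire class `ξ` complete: it is upper semi-Baire class `ξ`, and
every upper semi-Baire class `ξ` function `g : 2^ω → K` on the Cantor space factors as `f ∘ φ`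
with `φ` continuous. -/
def UpperSemiBaireComplete {X : Type*} [TopologicalSpace X] [PolishSpace X] {K : Set EReal}
    (ξ : Ordinal.{0}) (f : X → K) : Prop :=
  UpperSemiBaire ξ f ∧
    ∀ g : (ℕ → Bool) → K, UpperSemiBaire ξ g →
      ∃ φ : (ℕ → Bool) → X, Continuous φ ∧ g = f ∘ φ

/-- A map is densely onto if the preimage of every singleton is dense in the domain. -/
def DenselyOnto {X Y : Type*} [TopologicalSpace X] (f : X → Y) : Prop :=
  ∀ t : Y, Dense (f ⁻¹' {t})

/-! ### Vertices, compatible sequences, target-controlled maps -/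

/-- The vertex set: pairs `(x, y)` of positive integers with `x < y`. Its topology, inherited from
`ℕ × ℕ`, is the discrete one. -/
abbrev V : Type := {p : ℕ × ℕ // 0 < p.1 ∧ p.1 < p.2}

/-- The pairs of vertices `((x₁, y₁), (x₂, y₂))` with `x₂ = y₁`. -/
def W : Set (V × V) := {e | e.2.val.1 = e.1.val.2}

/-- The set of `B`-compatible sequences of vertices, as a subset of the product space `V^ω`
(sequences are indexed from `0`). -/
def P (B : Set (V × V)) : Set (ℕ → V) := {v | ∀ n, (v n, v (n + 1)) ∈ B}

theorem isClosed_P (B : Set (V × V)) : IsClosed (P B) := by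
  have h : P B = ⋂ n, (fun v : ℕ → V => (v n, v (n + 1))) ⁻¹' B := by
    ext v; simp [P]
  rw [h]
  exact isClosed_iInter fun n => (isClosed_discrete B).preimage (by fun_prop)

instance (B : Set (V × V)) : PolishSpace (P B) := (isClosed_P B).polishSpace

/-- The map `l : V → [b, ∞)` is `(B, b)`-target-controlled. -/
def TargetControlled (B : Set (V × V)) (b : EReal) (l : V → Ico b ⊤) : Prop :=
  ∀ ε : ℝ, 0 < ε → ε < 1 → ∃ M : ℕ, 0 < M ∧
    ∀ t : ℝ, b ≤ (t : EReal) → ∀ v : V, M < v.val.2 →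
      ∃ w : V, (v, w) ∈ B ∧ (t : EReal) ≤ (l w : EReal) ∧ (l w : EReal) < ((t + ε : ℝ) : EReal)

theorem le_limsup_vertex {b : EReal} (l : V → Ico b ⊤) (v : ℕ → V) :
    b ≤ limsup (fun n => (l (v n) : EReal)) atTop :=
  le_limsup_of_frequently_le (Frequently.of_forall fun n => (l (v n)).2.1)

/-- The map `P → [b, ∞]` sending `(v_n)` to the limit superior of `l (v_n)`. -/
noncomputable def limsupMap (B : Set (V × V)) (b : EReal) (l : V → Ico b ⊤) :
    P B → Icc b (⊤ : EReal) :=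
  fun v => ⟨limsup (fun n => (l (v.val n) : EReal)) atTop, le_limsup_vertex l v.val, le_top⟩

end BaireComplete

namespace BaireComplete

/-! ### Low levels of the Borel hierarchy -/

/-! If g is upper semi-Baire class 1, its superlevel sets are Gδ, and this makes g the pointwise
limsup of locally constant real functions `h n` that are at least b
(`exists_isLocallyConstant_isLimsup`). Target control turns targets into an orbit: at each step one
moves to a vertex whose value exceeds `h n x` by less than an error that vanishes because second
coordinates grow along B-paths. The limsup of the values is then g x
(`TargetControlled.exists_orbit`), and x ↦ orbit is continuous because each vertex depends on
finitely many locally constant targets. For density, a long initial segment of a given path is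
continued by such an orbit. -/

theorem IsSigma0.isOpen_of_lt_two {X : Type*} [TopologicalSpace X] {ξ : Ordinal.{0}} {A : Set X}
    (h : IsSigma0 ξ A) (hξ : ξ < 1 + 1) : IsOpen A := by
  cases h with
  | of_isOpen _ hA => exact hA
  | iUnion _ h1 A η hη hA =>
    rw [← Order.succ_eq_add_one, Order.lt_succ_iff] at hξ
    exact absurd h1 (not_lt.2 hξ)

theorem IsSigma0.isGδ_compl {X : Type*} [TopologicalSpace X] {ξ : Ordinal.{0}} {A : Set X}
    (h : IsSigma0 ξ A) (hξ : ξ = 1 + 1) : IsGδ Aᶜ := by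
  cases h with
  | of_isOpen _ hA => simp at hξ
  | iUnion _ h1 A η hη hA =>
    subst hξ
    rw [compl_iUnion]
    exact IsGδ.iInter_of_isOpen fun j => (hA j).isOpen_of_lt_two (hη j)

theorem isSigma0_two_iUnion {X : Type*} [TopologicalSpace X] {ι : Type*} [Countable ι] [Nonempty ι]
    {A : ι → Set X} (hA : ∀ i, IsClosed (A i)) : IsSigma0 (1 + 1) (⋃ i, A i) := by
  obtain ⟨e, he⟩ := exists_surjective_nat ι
  rw [← he.iUnion_comp]
  have h1 : (1 : Ordinal.{0}) < 1 + 1 := by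
    rw [← Order.succ_eq_add_one]; exact Order.lt_succ 1
  exact .iUnion _ h1 _ (fun _ => 1) (fun _ => h1) fun j => .of_isOpen _ (hA _).isOpen_compl

/-! ### Locally constant approximations in the limit superior -/

/-- The points whose cylinder of length `i`, and no shorter one, is contained in `U`. -/
def firstEntry (U : Set (ℕ → Bool)) (i : ℕ) : Set (ℕ → Bool) :=
  {x | PiNat.cylinder x i ⊆ U ∧ ∀ i' < i, ¬ PiNat.cylinder x i' ⊆ U}

theorem isClopen_setOf_cylinder_subset (U : Set (ℕ → Bool)) (i : ℕ) :
    IsClopen {x : ℕ → Bool | PiNat.cylinder x i ⊆ U} := by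
  have key : ∀ x y : ℕ → Bool, y ∈ PiNat.cylinder x i →
      PiNat.cylinder y i = PiNat.cylinder x i := fun x y h => PiNat.mem_cylinder_iff_eq.1 h
  constructor
  · rw [← isOpen_compl_iff, isOpen_iff_mem_nhds]
    intro x hx
    filter_upwards [(PiNat.isOpen_cylinder (fun _ => Bool) x i).mem_nhds
      (PiNat.self_mem_cylinder x i)] with y hy
    simpa [key x y hy] using hx
  · rw [isOpen_iff_mem_nhds]
    intro x hx
    filter_upwards [(PiNat.isOpen_cylinder (fun _ => Bool) x i).mem_nhds
      (PiNat.self_mem_cylinder x i)] with y hy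
    simpa [key x y hy] using hx

theorem isClopen_firstEntry (U : Set (ℕ → Bool)) (i : ℕ) : IsClopen (firstEntry U i) := by
  have : firstEntry U i = {x | PiNat.cylinder x i ⊆ U} ∩
      ⋂ i' ∈ Iio i, {x | PiNat.cylinder x i' ⊆ U}ᶜ := by
    ext x; simp [firstEntry]
  rw [this]
  exact (isClopen_setOf_cylinder_subset U i).inter
    ((finite_Iio i).isClopen_biInter fun i' _ => (isClopen_setOf_cylinder_subset U i').compl)

theorem mem_of_mem_firstEntry {U : Set (ℕ → Bool)} {i : ℕ} {x : ℕ → Bool}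
    (h : x ∈ firstEntry U i) : x ∈ U :=
  h.1 (PiNat.self_mem_cylinder x i)

theorem exists_mem_firstEntry {U : Set (ℕ → Bool)} (hU : IsOpen U) {x : ℕ → Bool} (hx : x ∈ U) :
    ∃ i, x ∈ firstEntry U i := by
  classical
  have h : ∃ i, PiNat.cylinder x i ⊆ U := by
    obtain ⟨v, ⟨y, n, rfl⟩, hxv, hv⟩ :=
      (PiNat.isTopologicalBasis_cylinders (fun _ => Bool)).exists_subset_of_mem_open hx hU
    exact ⟨n, by rwa [PiNat.mem_cylinder_iff_eq.1 hxv]⟩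
  exact ⟨Nat.find h, Nat.find_spec h, fun i' hi' => Nat.find_min h hi'⟩

theorem eq_of_mem_firstEntry {U : Set (ℕ → Bool)} {i j : ℕ} {x : ℕ → Bool}
    (hi : x ∈ firstEntry U i) (hj : x ∈ firstEntry U j) : i = j :=
  le_antisymm (not_lt.1 fun h => hi.2 _ h hj.1) (not_lt.1 fun h => hj.2 _ h hi.1)

/-- `IsLimsup t h`: the real sequence `h` has limit superior `t`, tested on rationals. -/
def IsLimsup (t : EReal) (h : ℕ → ℝ) : Prop :=
  (∀ q : ℚ, t < ((q : ℝ) : EReal) → ∀ᶠ n in atTop, h n < q) ∧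
    ∀ q : ℚ, ((q : ℝ) : EReal) < t → ∃ᶠ n in atTop, (q : ℝ) ≤ h n

/-- Real default values are needed even when b is -∞; they must not raise a limsup that is already
at least b. -/
theorem exists_seq_eventually_lt (b : EReal) (hb : b < ⊤) :
    ∃ d : ℕ → ℝ, (∀ n, b ≤ (d n : EReal)) ∧
      ∀ q : ℚ, b < ((q : ℝ) : EReal) → ∀ᶠ n in atTop, d n < q := by
  induction b with
  | bot =>
    refine ⟨fun n => -n, fun n => bot_le, fun q _ => ?_⟩
    exact (tendsto_neg_atTop_atBot.comp tendsto_natCast_atTop_atTop).eventually_lt_atBot _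
  | coe r => exact ⟨fun _ => r, fun n => le_rfl, fun q h => .of_forall fun _ => by simpa using h⟩
  | top => exact absurd hb (lt_irrefl _)

/-- A function on the Cantor space whose superlevel sets are `Gδ` sets is a limit superior of
locally constant functions. -/
theorem exists_isLocallyConstant_isLimsup {b : EReal} (hb : b < ⊤) (g : (ℕ → Bool) → EReal)
    (hbg : ∀ x, b ≤ g x) (hg : ∀ r : ℝ, IsGδ {x | (r : EReal) ≤ g x}) :
    ∃ h : ℕ → (ℕ → Bool) → ℝ, (∀ n, IsLocallyConstant (h n)) ∧ (∀ n x, b ≤ (h n x : EReal)) ∧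
      ∀ x, IsLimsup (g x) fun n => h n x := by
  classical
  obtain ⟨d, hbd, hd⟩ := exists_seq_eventually_lt b hb
  obtain ⟨e, he⟩ := exists_surjective_nat ℚ
  choose F hFo hF using fun j => (isGδ_iff_eq_iInter_nat.1 (hg (e j)))
  have hF' : ∀ j x, ((e j : ℝ) : EReal) ≤ g x ↔ ∀ m, x ∈ F j m := fun j x => by
    have := Set.ext_iff.1 (hF j) x
    simpa using this
  -- Testing all earlier thresholds below `e k` as well means that one failure at `e j` excludes
  -- every large `k` with `e j ≤ e k`, for all `n`.
  let U : ℕ → ℕ → Set (ℕ → Bool) := fun k n =>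
    ⋂ j ∈ {j | j ≤ k ∧ e j ≤ e k}, ⋂ m ∈ Iic (k + n), F j m
  have memU : ∀ {k n x}, x ∈ U k n ↔ ∀ j ≤ k, e j ≤ e k → ∀ m ≤ k + n, x ∈ F j m := by
    intro k n x; simp [U]
  have hUo : ∀ k n, IsOpen (U k n) := fun k n =>
    ((finite_Iic k).subset fun j hj => hj.1).isOpen_biInter fun j _ =>
      (finite_Iic _).isOpen_biInter fun m _ => hFo j m
  -- An index codes (k, n, i). Each x in `U k n` enters at exactly one i, so the value `e k` is
  -- proposed once per n with x in `U k n`.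
  let p : ℕ ≃ ℕ × ℕ × ℕ := (Denumerable.eqv _).symm
  let D : ℕ → Set (ℕ → Bool) := fun s => firstEntry (U (p s).1 (p s).2.1) (p s).2.2
  let h : ℕ → (ℕ → Bool) → ℝ := fun s x => if x ∈ D s then max (e (p s).1 : ℝ) (d s) else d s
  refine ⟨h, fun s => ?_, fun s x => ?_, fun x => ⟨fun q hq => ?_, fun q hq => ?_⟩⟩
  · rw [IsLocallyConstant.iff_eventually_eq]
    intro x
    have hD : IsClopen (D s) := isClopen_firstEntry _ _
    by_cases hx : x ∈ D s
    · filter_upwards [hD.isOpen.mem_nhds hx] with y hy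
      simp [h, hx, hy]
    · filter_upwards [hD.compl.isOpen.mem_nhds hx] with y hy
      have hy' : y ∉ D s := hy
      simp [h, hx, hy']
  · have : d s ≤ h s x := by
      simp only [h]; split_ifs
      · exact le_max_right _ _
      · exact le_rfl
    exact (hbd s).trans (by exact_mod_cast this)
  · obtain ⟨j, rfl⟩ := he q
    have hlt : ∀ k, e j ≤ e k → ∃ m, x ∉ F k m := fun k hk => by
      by_contra! hc
      have h1 := (hF' k x).2 hc
      have h2 : ((e j : ℝ) : EReal) ≤ ((e k : ℝ) : EReal) := by exact_mod_cast hk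
      exact absurd (h2.trans h1) (not_le.2 hq)
    obtain ⟨m₀, hm₀⟩ := hlt j le_rfl
    choose! m hm using hlt
    let K := j + m₀ + 1
    let N := (Finset.range K).sup m + 1
    -- The failure of x at `e j` bounds k, its failure at `e k` then bounds n, and (k, n) determines
    -- i.
    have hfin : {s | x ∈ D s ∧ e j ≤ e (p s).1}.Finite := by
      refine Set.Finite.of_finite_image (f := fun s => ((p s).1, (p s).2.1))
        (((finite_Iio K).prod (finite_Iio N)).subset ?_) ?_
      · rintro _ ⟨s, ⟨hxs, hjs⟩, rfl⟩
        have hU := memU.1 (mem_of_mem_firstEntry hxs)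
        have h1 : (p s).1 < K := by
          by_contra! hc
          exact hm₀ (hU j (by omega) hjs m₀ (by omega))
        refine ⟨h1, ?_⟩
        have h2 : m (p s).1 ≤ (Finset.range K).sup m := Finset.le_sup (Finset.mem_range.2 h1)
        change (p s).2.1 < N
        by_contra! hc
        exact hm _ hjs (hU _ le_rfl le_rfl _ (by omega))
      · rintro s ⟨hs, -⟩ s' ⟨hs', -⟩ hss
        simp only [Prod.mk.injEq] at hss
        apply p.injective
        refine Prod.ext hss.1 (Prod.ext hss.2 ?_)
        simp only [D] at hs hs'
        rw [hss.1, hss.2] at hs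
        exact eq_of_mem_firstEntry hs hs'
    have hev : ∀ᶠ s in atTop, ¬ (x ∈ D s ∧ e j ≤ e (p s).1) := by
      rw [← Nat.cofinite_eq_atTop]; exact hfin.eventually_cofinite_notMem
    filter_upwards [hev, hd _ ((hbg x).trans_lt hq)] with s hs hds
    simp only [h]
    split_ifs with hxs
    · refine max_lt ?_ hds
      exact_mod_cast not_le.1 fun hc => hs ⟨hxs, hc⟩
    · exact hds
  · obtain ⟨k, rfl⟩ := he q
    have hU : ∀ n, x ∈ U k n := fun n => memU.2 fun j _ hj m _ => by
      refine (hF' j x).1 (le_trans ?_ hq.le) m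
      exact_mod_cast hj
    choose i hi using fun n => exists_mem_firstEntry (hUo k n) (hU n)
    rw [Nat.frequently_atTop_iff_infinite]
    refine (infinite_range_of_injective (f := fun n => p.symm (k, n, i n)) fun n n' hn => ?_).mono ?_
    · simpa using congrArg (fun t => t.2.1) (p.symm.injective hn)
    · rintro _ ⟨n, rfl⟩
      have : x ∈ D (p.symm (k, n, i n)) := by simpa [D] using hi n
      simp [h, this]

/-! ### Orbits following prescribed targets -/

/-- A successor function for target-controlled maps: past some vertex, it follows the targets
with an error tending to zero. -/
theorem TargetControlled.exists_step {B : Set (V × V)} {b : EReal} {l : V → Ico b ⊤}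
    (hl : TargetControlled B b l) :
    ∃ (M : ℕ) (δ : V → ℝ) (s : V → ℝ → V),
      (∀ ε > 0, ∃ N : ℕ, ∀ v : V, N < v.val.2 → δ v < ε) ∧
      ∀ (v : V) (t : ℝ), M < v.val.2 → b ≤ t →
        (v, s v t) ∈ B ∧ (t : EReal) ≤ l (s v t) ∧ (l (s v t) : EReal) < ((t + δ v : ℝ) : EReal) := by
  classical
  have hε : ∀ k : ℕ, (0 : ℝ) < 1 / (k + 2) ∧ (1 : ℝ) / (k + 2) < 1 := fun k => by
    have : (0 : ℝ) ≤ k := k.cast_nonneg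
    exact ⟨by positivity, by rw [div_lt_one (by positivity)]; linarith⟩
  choose M _ hM using fun k : ℕ => hl _ (hε k).1 (hε k).2
  -- The finest precision available at `v`; the cap only makes the search finite.
  let κ : V → ℕ := fun v => Nat.findGreatest (fun k => M k < v.val.2) v.val.2
  have hκ : ∀ v : V, M 0 < v.val.2 → M (κ v) < v.val.2 := fun v hv =>
    Nat.findGreatest_spec (P := fun k => M k < v.val.2) (Nat.zero_le _) hv
  have hstep : ∀ (v : V) (t : ℝ), ∃ w : V, M 0 < v.val.2 → b ≤ t →
      (v, w) ∈ B ∧ (t : EReal) ≤ l w ∧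
        (l w : EReal) < ((t + 1 / ((κ v : ℝ) + 2) : ℝ) : EReal) := fun v t => by
    by_cases h : M 0 < v.val.2 ∧ b ≤ t
    · obtain ⟨w, hw⟩ := hM (κ v) t h.2 v (hκ v h.1)
      exact ⟨w, fun _ _ => hw⟩
    · exact ⟨v, fun h1 h2 => absurd ⟨h1, h2⟩ h⟩
  choose s hs using hstep
  refine ⟨M 0, fun v => 1 / ((κ v : ℝ) + 2), s, fun ε hε => ?_, hs⟩
  obtain ⟨K, hK⟩ := exists_nat_one_div_lt hε
  refine ⟨max K (M K), fun v hv => lt_of_le_of_lt ?_ hK⟩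
  have h1 : K ≤ κ v := Nat.le_findGreatest (P := fun k => M k < v.val.2)
    ((le_max_left _ _).trans hv.le) ((le_max_right _ _).trans_lt hv)
  have h2 : (K : ℝ) ≤ κ v := by exact_mod_cast h1
  exact one_div_le_one_div_of_le (by positivity) (by linarith)

/-- The sequence that starts with `v₀` and follows the targets `t` under the successor `s`. -/
def orbit (s : V → ℝ → V) (v₀ : V) (t : ℕ → ℝ) : ℕ → V
  | 0 => v₀
  | n + 1 => s (orbit s v₀ t n) (t n)

theorem add_le_snd_of_mem_P {B : Set (V × V)} (hB : B ⊆ W) {v : ℕ → V} (hv : v ∈ P B) (n : ℕ) :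
    (v 0).val.2 + n ≤ (v n).val.2 := by
  induction n with
  | zero => simp
  | succ n ih =>
    have h1 : (v (n + 1)).val.1 = (v n).val.2 := hB (hv n)
    have h2 := (v (n + 1)).property.2
    omega

theorem orbit_mem_P {B : Set (V × V)} (hB : B ⊆ W) {b : EReal} {s : V → ℝ → V} {M : ℕ}
    (hs : ∀ (v : V) (t : ℝ), M < v.val.2 → b ≤ t → (v, s v t) ∈ B) {v₀ : V} (hv₀ : M < v₀.val.2)
    {t : ℕ → ℝ} (ht : ∀ n, b ≤ t n) :
    orbit s v₀ t ∈ P B := by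
  have hM : ∀ n, M < (orbit s v₀ t n).val.2 := fun n => by
    induction n with
    | zero => exact hv₀
    | succ n ih =>
      have h1 : (orbit s v₀ t (n + 1)).val.1 = (orbit s v₀ t n).val.2 := hB (hs _ _ ih (ht n))
      have h2 := (orbit s v₀ t (n + 1)).property.2
      omega
  exact fun n => hs _ _ (hM n) (ht n)

theorem limsup_eq_of_isLimsup {τ : EReal} {h δ : ℕ → ℝ} (hτ : IsLimsup τ h)
    (hδ : ∀ ε > 0, ∀ᶠ n in atTop, δ n < ε) {u : ℕ → EReal} (hu : ∀ n, (h n : EReal) ≤ u n)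
    (hu' : ∀ n, u n < ((h n + δ n : ℝ) : EReal)) : limsup u atTop = τ := by
  apply le_antisymm
  · refine le_of_forall_gt_imp_ge_of_dense fun c hc => ?_
    obtain ⟨q, hq, hqc⟩ := EReal.exists_rat_btwn_of_lt hc
    obtain ⟨q', hq', hqq⟩ := EReal.exists_rat_btwn_of_lt hq
    have hlt : (q' : ℝ) < q := by exact_mod_cast hqq
    refine le_trans (limsup_le_of_le (by isBoundedDefault) ?_) hqc.le
    filter_upwards [hτ.1 q' hq', hδ (q - q') (by linarith)] with n h1 h2
    refine (hu' n).le.trans ?_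
    exact_mod_cast (by linarith : h n + δ n ≤ q)
  · refine le_of_forall_lt_imp_le_of_dense fun c hc => ?_
    obtain ⟨q, hcq, hq⟩ := EReal.exists_rat_btwn_of_lt hc
    refine hcq.le.trans (le_limsup_of_frequently_le ((hτ.2 q hq).mono fun n hn => ?_)
      (by isBoundedDefault))
    exact le_trans (by exact_mod_cast hn) (hu n)

/-- From all vertices with large second coordinate one can follow targets continuously, so that
the values of a target-controlled map have the limit superior of the targets. -/
theorem TargetControlled.exists_orbit {B : Set (V × V)} (hB : B ⊆ W) {b : EReal} {l : V → Ico b ⊤}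
    (hl : TargetControlled B b l) :
    ∃ (M : ℕ) (s : V → ℝ → V), ∀ v₀ : V, M < v₀.val.2 → ∀ t : ℕ → ℝ, (∀ n, b ≤ t n) →
      orbit s v₀ t ∈ P B ∧ ∀ τ : EReal, IsLimsup τ t →
        limsup (fun n => (l (orbit s v₀ t n) : EReal)) atTop = τ := by
  obtain ⟨M, δ, s, hδ, hs⟩ := hl.exists_step
  refine ⟨M, s, fun v₀ hv₀ t ht => ?_⟩
  have hP := orbit_mem_P hB (fun v t h1 h2 => (hs v t h1 h2).1) hv₀ ht
  refine ⟨hP, fun τ hτ => ?_⟩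
  have hgrow := add_le_snd_of_mem_P hB hP
  have hM : ∀ n, M < (orbit s v₀ t n).val.2 := fun n =>
    lt_of_lt_of_le hv₀ (le_trans (Nat.le_add_right _ _) (hgrow n))
  -- Target n is met at vertex n + 1.
  rw [← limsup_nat_add _ 1]
  refine limsup_eq_of_isLimsup (δ := fun n => δ (orbit s v₀ t n)) hτ (fun ε hε => ?_)
    (fun n => (hs _ _ (hM n) (ht n)).2.1) (fun n => (hs _ _ (hM n) (ht n)).2.2)
  obtain ⟨N, hN⟩ := hδ ε hε
  filter_upwards [eventually_gt_atTop N] with n hn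
  have := hgrow n
  exact hN _ (by omega)

/-- No regularity of `s` in the target is needed, since the targets themselves are locally constant.
-/
theorem isLocallyConstant_orbit {X : Type*} [TopologicalSpace X] (s : V → ℝ → V) (v₀ : V)
    {h : ℕ → X → ℝ} (hh : ∀ n, IsLocallyConstant (h n)) (n : ℕ) :
    IsLocallyConstant fun x => orbit s v₀ (fun n => h n x) n := by
  induction n with
  | zero => exact IsLocallyConstant.const v₀
  | succ n ih => exact ih.comp₂ (hh n) s

/-! ### The map `limsupMap` -/

theorem upperSemiBaire_limsupMap (B : Set (V × V)) (b : EReal) (l : V → Ico b ⊤) :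
    UpperSemiBaire 1 (limsupMap B b l) := by
  intro r
  -- A limsup is below r iff some rational q < r bounds a tail.
  let A : {q : ℚ // (q : ℝ) < r} × ℕ → Set (P B) := fun p =>
    ⋂ n ∈ Ici p.2, (fun v : P B => v.val n) ⁻¹' {w | (l w : EReal) ≤ ((p.1.val : ℝ) : EReal)}
  have hA : {v | (limsupMap B b l v : EReal) < r} = ⋃ p, A p := by
    ext v
    simp only [mem_ofPred_eq, mem_iUnion, A, mem_iInter, mem_preimage, limsupMap]
    constructor
    · intro h
      obtain ⟨q, hq, hqr⟩ := EReal.exists_rat_btwn_of_lt h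
      obtain ⟨N, hN⟩ := eventually_atTop.1 (eventually_lt_of_limsup_lt hq (by isBoundedDefault))
      exact ⟨(⟨q, by exact_mod_cast hqr⟩, N), fun n hn => (hN n hn).le⟩
    · rintro ⟨⟨q, N⟩, hN⟩
      refine lt_of_le_of_lt (limsup_le_of_le (by isBoundedDefault)
        (eventually_atTop.2 ⟨N, fun n hn => hN n hn⟩)) ?_
      exact_mod_cast q.2
  have : Nonempty {q : ℚ // (q : ℝ) < r} := nonempty_subtype.2 (exists_rat_lt r)
  rw [hA]
  refine isSigma0_two_iUnion fun p => isClosed_biInter fun n _ => ?_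
  exact (isClosed_discrete _).preimage ((continuous_apply n).comp continuous_subtype_val)

theorem denselyOnto_limsupMap {B : Set (V × V)} (hB : B ⊆ W) {b : EReal} (hb : b < ⊤)
    {l : V → Ico b ⊤} (hl : TargetControlled B b l) : DenselyOnto (limsupMap B b l) := by
  intro τ v
  obtain ⟨M, s, hs⟩ := hl.exists_orbit hB
  obtain ⟨h, -, hbh, hlim⟩ := exists_isLocallyConstant_isLimsup hb (fun _ => (τ : EReal))
    (fun _ => τ.2.1) (fun r => by by_cases hr : (r : EReal) ≤ τ <;> simp [hr])
  let t : ℕ → ℝ := fun n => h n fun _ => false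
  have hgrow := add_le_snd_of_mem_P hB v.2
  -- Branching off at time N + M puts the second coordinate past the threshold `M`.
  have hv : ∀ N, M < (v.val (N + M)).val.2 := fun N => by
    have h1 := hgrow (N + M)
    have h2 := (v.val 0).property
    omega
  let o : ℕ → ℕ → V := fun N => orbit s (v.val (N + M)) t
  have ho := fun N => hs _ (hv N) t fun n => hbh n _
  let u : ℕ → ℕ → V := fun N n => if n < N + M then v.val n else o N (n - (N + M))
  have huP : ∀ N, u N ∈ P B := fun N n => by
    by_cases h1 : n + 1 < N + M
    · have h2 : n < N + M := by omega
      simpa [u, h1, h2] using v.2 n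
    · by_cases h2 : n < N + M
      · have h3 : n + 1 = N + M := by omega
        have h4 : u N (n + 1) = v.val (n + 1) := by simp [u, h3, o, orbit]
        rw [h4]
        simpa [u, h2] using v.2 n
      · have h3 : n + 1 - (N + M) = n - (N + M) + 1 := by omega
        simpa [u, h1, h2, h3] using (ho N).1 (n - (N + M))
  have hlimsup : ∀ N, limsupMap B b l ⟨u N, huP N⟩ = τ := fun N => by
    apply Subtype.ext
    rw [← (ho N).2 τ (hlim _)]
    change limsup (fun n => (l (u N n) : EReal)) atTop = _
    rw [← limsup_nat_add _ (N + M)]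
    simp [u, o]
  refine mem_closure_of_tendsto (f := fun N => (⟨u N, huP N⟩ : P B)) (b := atTop) ?_
    (.of_forall hlimsup)
  rw [tendsto_subtype_rng, tendsto_pi_nhds]
  intro n
  refine tendsto_const_nhds.congr' ?_
  filter_upwards [eventually_gt_atTop n] with N hN
  have : n < N + M := by omega
  simp [u, this]

theorem upperSemiBaireComplete_limsupMap {B : Set (V × V)} (hB : B ⊆ W) {b : EReal} (hb : b < ⊤)
    {l : V → Ico b ⊤} (hl : TargetControlled B b l) :
    UpperSemiBaireComplete 1 (limsupMap B b l) := by
  refine ⟨upperSemiBaire_limsupMap B b l, fun g hg => ?_⟩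
  obtain ⟨M, s, hs⟩ := hl.exists_orbit hB
  obtain ⟨h, hloc, hbh, hlim⟩ := exists_isLocallyConstant_isLimsup hb (fun x => (g x : EReal))
    (fun x => (g x).2.1) (fun r => by simpa [compl_ofPred] using (hg r).isGδ_compl rfl)
  let v₀ : V := ⟨(1, M + 2), by simp⟩
  have ho := fun x => hs v₀ (by simp [v₀]) (fun n => h n x) fun n => hbh n x
  refine ⟨fun x => ⟨orbit s v₀ fun n => h n x, (ho x).1⟩, ?_, ?_⟩
  · exact Continuous.subtype_mk
      (continuous_pi fun n => (isLocallyConstant_orbit s v₀ hloc n).continuous) _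
  · funext x
    exact Subtype.ext ((ho x).2 _ (hlim x)).symm

end BaireComplete

theorem mainTheorem2 (B : Set (BaireComplete.V × BaireComplete.V)) (hB : B ⊆ BaireComplete.W)
    (b : EReal) (hb : b < ⊤) (l : BaireComplete.V → Set.Ico b ⊤)
    (hl : BaireComplete.TargetControlled B b l) :
    BaireComplete.DenselyOnto (BaireComplete.limsupMap B b l) ∧
      BaireComplete.UpperSemiBaireComplete 1 (BaireComplete.limsupMap B b l) :=
  ⟨BaireComplete.denselyOnto_limsupMap hB hb hl,
    BaireComplete.upperSemiBaireComplete_limsupMap hB hb hl⟩
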